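/- All $C^*$-algebras are unital; morphisms are unital $*$-homomorphisms; $\otimes$ is the spatial tensor product of $C^*$-algebras. A unital completely positive linear map $\mathcal F:B\to A$ between $C^*$-algebras is \emph{implemented by} $(C,\phi,\nu)$, where $C$ is a $C^*$-algebra, $\phi:B\to A\otimes C$ is a morphism and $\nu$ is a state of $C$, if $\mathcal F(b)=(\mathrm{id}_A\otimes\nu)(\phi(b))$ for all $b\in B$; here $\mathrm{id}_A\otimes\nu:A\otimes C\to A$ is the bounded linear map with $a\otimes c\mapsto\nu(c)a$. It is \emph{implemented} if it is implemented by some such triple. **Theorem.** Let $B$ be a $C^*$-algebra, $K$ a complex Hilbert space, $H\subseteq K$ a closed subspace, $\mathcal L(\cdot)$ the algebra of bounded operators, and $\mathcal F:B\to\mathcal L(H)$ a unital completely positive linear map. Let $\psi:B\to\mathcal L(K)$ be a morphism with $\mathcal F(b)=P_H\psi(b)|_H$ for all $b\in B$, where $P_H:K\to H$ is the orthogonal projection. (i) If $H$ and $K$ are separable and infinite-dimensional and $H^\perp$ (the orthogonal complement of $H$ in $K$) is infinite-dimensional, then $\mathcal F$ is implemented; more precisely, it is implemented by $(\mathrm M_2,\phi,\sigma)$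 for some morphism $\phi:B\to\mathcal L(H)\otimes\mathrm M_2$, where $\sigma((m_{ij}))=m_{11}$. (ii) If $\dim K<\infty$ and $\dim K$ is a multiple of $\dim H$, then $\mathcal F$ is implemented; more precisely, for every integer $n\ge 1$ with $\dim K=n\dim H$ it is implemented by $(\mathrm M_n,\phi,\sigma)$ for some morphism $\phi:B\to\mathcal L(H)\otimes\mathrm M_n$, where $\sigma((m_{ij}))=m_{11}$. -/

import Mathlib

open UniformSpace (Completion)
open scoped TensorProduct ComplexOrder InnerProductSpace ENNReal CStarAlgebra

noncomputable section

/-! ## Operators on the Hilbert space tensor product -/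

section HilbertTensor

variable (E F : Type*) [NormedAddCommGroup E] [InnerProductSpace ℂ E]
  [NormedAddCommGroup F] [InnerProductSpace ℂ F]

/-- The Hilbert space tensor product: completion of the algebraic tensor product with
`⟪x ⊗ y, x' ⊗ y'⟫ = ⟪x, x'⟫ * ⟪y, y'⟫`. -/
abbrev HilbertTensor : Type _ := Completion (E ⊗[ℂ] F)

variable {E F}

/-- The operator `S ⊗ T` on the Hilbert space tensor product. -/
def opTensor (S : E →L[ℂ] E) (T : F →L[ℂ] F) : HilbertTensor E F →L[ℂ] HilbertTensor E F :=
  (TensorProduct.mapL S T).completion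

@[simp]
theorem opTensor_tmul (S : E →L[ℂ] E) (T : F →L[ℂ] F) (x : E) (y : F) :
    opTensor S T ((x ⊗ₜ[ℂ] y : E ⊗[ℂ] F) : HilbertTensor E F) =
      ((S x ⊗ₜ[ℂ] T y : E ⊗[ℂ] F) : HilbertTensor E F) := by
  simp [opTensor]

theorem hilbertTensor_clm_ext {G : Type*} [NormedAddCommGroup G] [NormedSpace ℂ G]
    {U V : HilbertTensor E F →L[ℂ] G}
    (h : ∀ (x : E) (y : F), U ((x ⊗ₜ[ℂ] y : E ⊗[ℂ] F) : HilbertTensor E F) =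
      V ((x ⊗ₜ[ℂ] y : E ⊗[ℂ] F) : HilbertTensor E F)) : U = V := by
  ext z
  induction z using Completion.induction_on with
  | hp => exact isClosed_eq U.continuous V.continuous
  | ih z =>
    induction z using TensorProduct.induction_on with
    | zero => rw [Completion.coe_zero, map_zero, map_zero]
    | tmul x y => exact h x y
    | add z w hz hw => rw [Completion.coe_add, map_add, map_add, hz, hw]

theorem opTensor_mul (S S' : E →L[ℂ] E) (T T' : F →L[ℂ] F) :
    opTensor S T * opTensor S' T' = opTensor (S * S') (T * T') :=
  hilbertTensor_clm_ext fun x y => by simp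

theorem opTensor_one : opTensor (1 : E →L[ℂ] E) (1 : F →L[ℂ] F) = 1 :=
  hilbertTensor_clm_ext fun x y => by simp

theorem opTensor_add_left (S S' : E →L[ℂ] E) (T : F →L[ℂ] F) :
    opTensor (S + S') T = opTensor S T + opTensor S' T :=
  hilbertTensor_clm_ext fun x y => by
    simp [TensorProduct.add_tmul, Completion.coe_add]

theorem opTensor_add_right (S : E →L[ℂ] E) (T T' : F →L[ℂ] F) :
    opTensor S (T + T') = opTensor S T + opTensor S T' :=
  hilbertTensor_clm_ext fun x y => by
    simp [TensorProduct.tmul_add, Completion.coe_add]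

theorem opTensor_smul_left (r : ℂ) (S : E →L[ℂ] E) (T : F →L[ℂ] F) :
    opTensor (r • S) T = r • opTensor S T :=
  hilbertTensor_clm_ext fun x y => by
    simp [← TensorProduct.smul_tmul']

theorem opTensor_smul_right (r : ℂ) (S : E →L[ℂ] E) (T : F →L[ℂ] F) :
    opTensor S (r • T) = r • opTensor S T :=
  hilbertTensor_clm_ext fun x y => by
    simp

theorem opTensor_star [CompleteSpace E] [CompleteSpace F] (S : E →L[ℂ] E) (T : F →L[ℂ] F) :
    star (opTensor S T) = opTensor (star S) (star T) := by
  symm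
  refine (ContinuousLinearMap.eq_adjoint_iff _ (opTensor S T)).2 ?_
  intro z w
  induction z, w using Completion.induction_on₂ with
  | hp => apply isClosed_eq <;> fun_prop
  | ih z w =>
    induction z using TensorProduct.induction_on with
    | zero => rw [Completion.coe_zero, map_zero, inner_zero_left, inner_zero_left]
    | add z z' hz hz' =>
      rw [Completion.coe_add, map_add, inner_add_left, inner_add_left, hz, hz']
    | tmul x y =>
      induction w using TensorProduct.induction_on with
      | zero => rw [Completion.coe_zero, map_zero, inner_zero_right, inner_zero_right]
      | add w w' hw hw' =>
        rw [Completion.coe_add, map_add, inner_add_right, inner_add_right, hw, hw']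
      | tmul x' y' =>
        simp [ContinuousLinearMap.star_eq_adjoint, ContinuousLinearMap.adjoint_inner_left]

variable (E F) in
/-- `S ↦ S ⊗ 1`. -/
def opTensorLeft [CompleteSpace E] [CompleteSpace F] :
    (E →L[ℂ] E) →⋆ₐ[ℂ] (HilbertTensor E F →L[ℂ] HilbertTensor E F) where
  toFun S := opTensor S 1
  map_one' := opTensor_one
  map_mul' x y := by rw [opTensor_mul, mul_one]
  map_zero' := by rw [← zero_smul ℂ 0, opTensor_smul_left, zero_smul]
  map_add' x y := by rw [opTensor_add_left]
  commutes' r := by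
    rw [Algebra.algebraMap_eq_smul_one, opTensor_smul_left, opTensor_one,
      Algebra.algebraMap_eq_smul_one]
  map_star' x := by rw [opTensor_star, star_one]

variable (E F) in
/-- `T ↦ 1 ⊗ T`. -/
def opTensorRight [CompleteSpace E] [CompleteSpace F] :
    (F →L[ℂ] F) →⋆ₐ[ℂ] (HilbertTensor E F →L[ℂ] HilbertTensor E F) where
  toFun T := opTensor 1 T
  map_one' := opTensor_one
  map_mul' x y := by rw [opTensor_mul, mul_one]
  map_zero' := by rw [← zero_smul ℂ 0, opTensor_smul_right, zero_smul]
  map_add' x y := by rw [opTensor_add_right]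
  commutes' r := by
    rw [Algebra.algebraMap_eq_smul_one, opTensor_smul_right, opTensor_one,
      Algebra.algebraMap_eq_smul_one]
  map_star' x := by rw [opTensor_star, star_one]

end HilbertTensor

/-! ## States and their GNS representations -/

section State

variable (A : Type*) [CStarAlgebra A] [PartialOrder A] [StarOrderedRing A]

/-- States of a unital C⋆-algebra: normalized positive linear functionals. -/
def CStarState : Type _ := {f : A →ₚ[ℂ] ℂ // f 1 = 1}

variable {A}

instance : CoeFun (CStarState A) (fun _ => A → ℂ) := ⟨fun f => f.1⟩

/-- The Hilbert space of the GNS representation of a state. -/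
abbrev CStarState.Space (f : CStarState A) : Type _ := f.1.GNS

instance (f : CStarState A) : Nontrivial f.Space := by
  refine ⟨⟨((f.1.toPreGNS 1 : f.1.PreGNS) : f.1.GNS), 0, fun h => ?_⟩⟩
  have h1 : ‖((f.1.toPreGNS 1 : f.1.PreGNS) : f.1.GNS)‖ = 1 := by
    rw [Completion.norm_coe, f.1.preGNS_norm_def]
    simp [f.2]
  rw [h, norm_zero] at h1
  exact zero_ne_one h1

end State

instance {E F : Type*} [NormedAddCommGroup E] [InnerProductSpace ℂ E]
    [NormedAddCommGroup F] [InnerProductSpace ℂ F] [Nontrivial E] [Nontrivial F] :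
    Nontrivial (HilbertTensor E F) := by
  obtain ⟨x, hx⟩ := exists_ne (0 : E)
  obtain ⟨y, hy⟩ := exists_ne (0 : F)
  refine ⟨⟨((x ⊗ₜ[ℂ] y : E ⊗[ℂ] F) : HilbertTensor E F), 0, fun h => ?_⟩⟩
  have h1 : ‖((x ⊗ₜ[ℂ] y : E ⊗[ℂ] F) : HilbertTensor E F)‖ = ‖x‖ * ‖y‖ := by
    rw [Completion.norm_coe, TensorProduct.norm_tmul]
  rw [h, norm_zero] at h1
  exact mul_ne_zero (norm_ne_zero_iff.2 hx) (norm_ne_zero_iff.2 hy) h1.symm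

/-! ## The spatial tensor product -/

section BoundedFamilies

variable {I : Type*} (D : I → Type*) [∀ i, CStarAlgebra (D i)] [∀ i, Nontrivial (D i)]

/-- Bounded families with the supremum norm form a C⋆-algebra. -/
instance lpInftyCStarAlgebra : CStarAlgebra (lp D ∞) where

end BoundedFamilies

section StarTensorLift

variable {A C X : Type*} [CStarAlgebra A] [CStarAlgebra C] [CStarAlgebra X]

/-- The ⋆-homomorphism `a ⊗ c ↦ l(a) r(c)` on the algebraic tensor product. -/
def starTensorLift (l : A →⋆ₐ[ℂ] X) (r : C →⋆ₐ[ℂ] X) (h : ∀ a c, Commute (l a) (r c)) :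
    A ⊗[ℂ] C →⋆ₐ[ℂ] X where
  __ := Algebra.TensorProduct.lift l.toAlgHom r.toAlgHom h
  map_star' x := by
    change Algebra.TensorProduct.lift l.toAlgHom r.toAlgHom h (star x) =
      star (Algebra.TensorProduct.lift l.toAlgHom r.toAlgHom h x)
    induction x using TensorProduct.induction_on with
    | zero => rw [star_zero, map_zero, star_zero]
    | add x y hx hy => rw [star_add, map_add, map_add, star_add, hx, hy]
    | tmul a c =>
      change l (star a) * r (star c) = star (l a * r c)
      rw [map_star, map_star, star_mul]
      exact (h a c).star_star.eq

/-- The norm closure of the range of a ⋆-homomorphism on the algebraic tensor product. -/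
def starTensorClosedRange (f : A ⊗[ℂ] C →⋆ₐ[ℂ] X) : StarSubalgebra ℂ X :=
  f.range.topologicalClosure

theorem mem_starTensorClosedRange (f : A ⊗[ℂ] C →⋆ₐ[ℂ] X) (t : A ⊗[ℂ] C) :
    f t ∈ starTensorClosedRange f :=
  f.range.le_topologicalClosure ⟨t, rfl⟩

theorem coe_starTensorClosedRange (f : A ⊗[ℂ] C →⋆ₐ[ℂ] X) :
    (starTensorClosedRange f : Set X) = closure (Set.range f) := rfl

end StarTensorLift

section Spatial

variable (A C : Type*) [CStarAlgebra A] [PartialOrder A] [StarOrderedRing A]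
  [CStarAlgebra C] [PartialOrder C] [StarOrderedRing C]

variable {A C} in
/-- The bounded operators on `H_f ⊗ H_g`, for states `f` of `A` and `g` of `C`. -/
abbrev SpatialFiber (p : CStarState A × CStarState C) : Type _ :=
  HilbertTensor p.1.Space p.2.Space →L[ℂ] HilbertTensor p.1.Space p.2.Space

variable {A C} in
instance spatialFiberCStarAlgebra (p : CStarState A × CStarState C) :
    CStarAlgebra (SpatialFiber p) := inferInstance

variable {A C} in
instance spatialFiberNontrivial (p : CStarState A × CStarState C) :
    Nontrivial (SpatialFiber p) := inferInstance

/-- The C⋆-algebra of bounded families of operators `(x_{f,g})`, where `f`, `g` run over the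
states of `A` and `C` and `x_{f,g}` acts on `H_f ⊗ H_g`, with the supremum norm. -/
def SpatialAmbient : Type _ :=
  lp (fun p : CStarState A × CStarState C => SpatialFiber p) ∞

/-- Kept semireducible so that instance search does not unfold `SpatialAmbient`. -/
def spatialAmbientStructure : CStarAlgebra (SpatialAmbient A C) :=
  lpInftyCStarAlgebra _

instance spatialAmbientCStarAlgebra : CStarAlgebra (SpatialAmbient A C) :=
  spatialAmbientStructure A C

variable {A C}

/-- The family `(S_{f,g})` obtained from representations `ρ_{f,g}` of a C⋆-algebra `D`. -/
def spatialFamily {D : Type*} [CStarAlgebra D]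
    (ρ : ∀ p : CStarState A × CStarState C, D →⋆ₐ[ℂ] SpatialFiber p) :
    D →⋆ₐ[ℂ] SpatialAmbient A C where
  toFun d := (⟨fun p => ρ p d, memℓp_infty ⟨‖d‖, by
    rintro _ ⟨p, rfl⟩
    exact NonUnitalStarAlgHom.norm_apply_le (ρ p) d⟩⟩ :
      lp (fun p : CStarState A × CStarState C => SpatialFiber p) ∞)
  map_one' := Subtype.ext (funext fun p => map_one (ρ p))
  map_mul' x y := Subtype.ext (funext fun p => map_mul (ρ p) x y)
  map_zero' := Subtype.ext (funext fun p => map_zero (ρ p))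
  map_add' x y := Subtype.ext (funext fun p => map_add (ρ p) x y)
  commutes' r := Subtype.ext (funext fun p => (ρ p).commutes r)
  map_star' x := Subtype.ext (funext fun p => map_star (ρ p) x)

/-- The component `x_{f,g}` of an element of the ambient algebra. -/
def SpatialAmbient.component (x : SpatialAmbient A C) (p : CStarState A × CStarState C) :
    SpatialFiber p :=
  (show lp (fun p : CStarState A × CStarState C => SpatialFiber p) ∞ from x) p

theorem SpatialAmbient.ext {x y : SpatialAmbient A C}
    (h : ∀ p, x.component p = y.component p) : x = y :=
  Subtype.ext (funext h)

theorem SpatialAmbient.component_mul (x y : SpatialAmbient A C)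
    (p : CStarState A × CStarState C) :
    (x * y).component p = x.component p * y.component p := rfl

variable (A C) in
/-- `a ↦ (π_f(a) ⊗ 1)_{f,g}`. -/
def spatialLeft : A →⋆ₐ[ℂ] SpatialAmbient A C :=
  spatialFamily fun p =>
    (opTensorLeft p.1.Space p.2.Space).comp p.1.1.gnsStarAlgHom

variable (A C) in
/-- `c ↦ (1 ⊗ π_g(c))_{f,g}`. -/
def spatialRight : C →⋆ₐ[ℂ] SpatialAmbient A C :=
  spatialFamily fun p =>
    (opTensorRight p.1.Space p.2.Space).comp p.2.1.gnsStarAlgHom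

theorem spatialLeft_component (a : A) (p : CStarState A × CStarState C) :
    (spatialLeft A C a).component p =
      opTensor (p.1.1.gnsStarAlgHom a) 1 := rfl

theorem spatialRight_component (c : C) (p : CStarState A × CStarState C) :
    (spatialRight A C c).component p =
      opTensor 1 (p.2.1.gnsStarAlgHom c) := rfl

theorem spatial_commute (a : A) (c : C) :
    Commute (spatialLeft A C a) (spatialRight A C c) :=
  SpatialAmbient.ext fun p => by
    rw [SpatialAmbient.component_mul, SpatialAmbient.component_mul, spatialLeft_component,
      spatialRight_component, opTensor_mul, opTensor_mul, mul_one, mul_one, one_mul, one_mul]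

variable (A C) in
/-- The representation `a ⊗ c ↦ (π_f(a) ⊗ π_g(c))_{f,g}` of the algebraic tensor product, where
`π_f`, `π_g` are the GNS representations. -/
def spatialHom : A ⊗[ℂ] C →⋆ₐ[ℂ] SpatialAmbient A C :=
  starTensorLift (spatialLeft A C) (spatialRight A C) spatial_commute

theorem spatialHom_tmul (a : A) (c : C) :
    spatialHom A C (a ⊗ₜ[ℂ] c) = spatialLeft A C a * spatialRight A C c := rfl

theorem spatialHom_tmul_component (a : A) (c : C) (p : CStarState A × CStarState C) :
    (spatialHom A C (a ⊗ₜ[ℂ] c)).component p =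
      opTensor (p.1.1.gnsStarAlgHom a) (p.2.1.gnsStarAlgHom c) := by
  rw [spatialHom_tmul, SpatialAmbient.component_mul, spatialLeft_component,
    spatialRight_component, opTensor_mul, mul_one, one_mul]

variable (A C) in
/-- The spatial tensor product of unital C⋆-algebras `A` and `C`: the completion of the algebraic
tensor product in the spatial norm `‖t‖ = sup_{f,g} ‖(π_f ⊗ π_g)(t)‖`, the supremum being over the
GNS representations of all states, realized as a closed ⋆-subalgebra. -/
def spatialTensor : StarSubalgebra ℂ (SpatialAmbient A C) :=
  starTensorClosedRange (spatialHom A C)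

variable (A C) in
/-- The underlying C⋆-algebra of `spatialTensor`. -/
abbrev SpatialTensor : Type _ := ↥(spatialTensor A C)

instance isClosed_spatialTensor : IsClosed (spatialTensor A C : Set (SpatialAmbient A C)) :=
  isClosed_closure

instance spatialTensorCStarAlgebra : CStarAlgebra (SpatialTensor A C) :=
  StarSubalgebra.cstarAlgebra (spatialTensor A C)

/-- The norm is the supremum of the norms of the components. -/
theorem spatialTensor_norm (x : SpatialTensor A C) :
    ‖x‖ = ⨆ p, ‖(x : SpatialAmbient A C).component p‖ :=
  lp.norm_eq_ciSup _

theorem spatialHom_mem (t : A ⊗[ℂ] C) : spatialHom A C t ∈ spatialTensor A C :=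
  mem_starTensorClosedRange (spatialHom A C) t

/-- The elementary tensor `a ⊗ c`. -/
def spatialTmul (a : A) (c : C) : SpatialTensor A C :=
  ⟨spatialHom A C (a ⊗ₜ[ℂ] c), spatialHom_mem _⟩

/-- `T` is the slice map `id ⊗ ν`: the bounded linear map with `a ⊗ c ↦ ν(c) a`. -/
def IsSliceMap (ν : CStarState C) (T : SpatialTensor A C →L[ℂ] A) : Prop :=
  ∀ (a : A) (c : C), T (spatialTmul a c) = ν c • a

/-- There is at most one slice map. -/
theorem IsSliceMap.unique {ν : CStarState C} {S T : SpatialTensor A C →L[ℂ] A}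
    (hS : IsSliceMap ν S) (hT : IsSliceMap ν T) : S = T := by
  have key : ∀ t : A ⊗[ℂ] C, ∀ h : spatialHom A C t ∈ spatialTensor A C,
      S ⟨spatialHom A C t, h⟩ = T ⟨spatialHom A C t, h⟩ := by
    intro t
    induction t using TensorProduct.induction_on with
    | zero =>
      intro h
      have : (⟨spatialHom A C 0, h⟩ : SpatialTensor A C) = 0 := Subtype.ext (map_zero _)
      rw [this, map_zero, map_zero]
    | tmul a c => exact fun h => (hS a c).trans (hT a c).symm
    | add x y hx hy =>
      intro h
      have : (⟨spatialHom A C (x + y), h⟩ : SpatialTensor A C) =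
          ⟨spatialHom A C x, spatialHom_mem x⟩ + ⟨spatialHom A C y, spatialHom_mem y⟩ :=
        Subtype.ext (map_add _ _ _)
      rw [this, map_add, map_add, hx, hy]
  have hcl : IsClosed {z : SpatialTensor A C | S z = T z} :=
    isClosed_eq S.continuous T.continuous
  ext ⟨x, hx⟩
  have hmem : (⟨x, hx⟩ : SpatialTensor A C) ∈
      closure {z : SpatialTensor A C | S z = T z} := by
    rw [closure_subtype]
    refine closure_mono ?_ (show x ∈ closure (Set.range (spatialHom A C)) from hx)
    rintro _ ⟨t, rfl⟩
    exact ⟨⟨spatialHom A C t, spatialHom_mem t⟩, key t _, rfl⟩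
  rwa [hcl.closure_eq] at hmem

end Spatial

/-! ## Random quantum maps -/

section RandomQuantumMaps

universe u v w

/-- A random quantum map from `B` to `A`: a quantum family of maps `φ : B → A ⊗ C` (a unital
⋆-homomorphism) together with a state `ν` on `C`. -/
structure RandomQuantumMap (B : Type u) (A : Type v) [CStarAlgebra B]
    [CStarAlgebra A] [PartialOrder A] [StarOrderedRing A] where
  /-- the parameter algebra -/
  C : Type w
  [cstarAlgebra : CStarAlgebra C]
  [partialOrder : PartialOrder C]
  [starOrderedRing : StarOrderedRing C]
  /-- the quantum family of maps -/
  φ : B →⋆ₐ[ℂ] SpatialTensor A C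
  /-- the state on the parameter algebra -/
  ν : CStarState C

variable {B : Type u} {A : Type v} [CStarAlgebra B] [PartialOrder B] [StarOrderedRing B]
  [CStarAlgebra A] [PartialOrder A] [StarOrderedRing A]

/-- `F b = (id ⊗ ν)(φ b)` for all `b`. -/
def ImplementedBy {C : Type w} [CStarAlgebra C] [PartialOrder C] [StarOrderedRing C]
    (F : B →CP A) (φ : B →⋆ₐ[ℂ] SpatialTensor A C) (ν : CStarState C) : Prop :=
  ∃ T : SpatialTensor A C →L[ℂ] A, IsSliceMap ν T ∧ ∀ b, F b = T (φ b)

/-- `F` is implemented by the random quantum map `R = (C, φ, ν)`. -/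
def RandomQuantumMap.Implements (R : RandomQuantumMap.{u, v, w} B A) (F : B →CP A) : Prop :=
  letI := R.cstarAlgebra
  letI := R.partialOrder
  letI := R.starOrderedRing
  ImplementedBy F R.φ R.ν

/-- `F` is implemented by some random quantum map. -/
def IsImplemented (F : B →CP A) : Prop :=
  ∃ R : RandomQuantumMap.{u, v, w} B A, R.Implements F

end RandomQuantumMaps

/-- The state `M ↦ M 0 0` on the C⋆-algebra of `n × n` matrices. -/
def cornerState (n : ℕ) [NeZero n] : CStarState (CStarMatrix (Fin n) (Fin n) ℂ) :=
  ⟨PositiveLinearMap.mk₀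
    { toFun M := M 0 0
      map_add' _ _ := rfl
      map_smul' _ _ := rfl }
    (fun M hM => by
      rw [StarOrderedRing.nonneg_iff] at hM
      change 0 ≤ M 0 0
      induction hM using AddSubmonoid.closure_induction with
      | mem x hx =>
        obtain ⟨b, rfl⟩ := hx
        change 0 ≤ ∑ k, star (b k 0) * b k 0
        exact Finset.sum_nonneg fun k _ => star_mul_self_nonneg _
      | zero => exact le_rfl
      | add x y _ _ hx hy => exact add_nonneg hx hy),
    by
      change (1 : CStarMatrix (Fin n) (Fin n) ℂ) 0 0 = 1
      simp⟩

end

/-! Suppose `K` is an orthogonal sum of `n` copies of `H`, the copy with index 0 being `H` itself.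
Then `L(K)` is identified with `M_n(L(H))`, and the (0,0) block of an operator is its compression to
`H`. Under `M_n(A) ≅ A ⊗ M_n` the slice by the corner state is exactly the (0,0) entry, so the
dilation `ψ`, read in `A ⊗ M_n`, already implements `F`. The two identifications are
`blockMatrixHom` and `IsMatrixUnits.toTensor`.

It remains to decompose `Hᗮ` into `n - 1` copies of `H`. In (i) one copy suffices, because all
separable infinite-dimensional Hilbert spaces are isometric; in (ii) it is a dimension count.
`IsIsometricDecomposition.cons_subtypeL` adds `H` itself.

The analytic point is the existence of the slice map on the spatial tensor product
(`exists_clm_of_starTensorClosedRange`). For a projection `p` with `p c p = ν(c) p`, compression by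
`1 ⊗ p` sends `a ⊗ c` to `ν(c) a ⊗ p`, and `a ↦ a ⊗ p` is an isometric copy of `A`. -/

noncomputable section

namespace SpatialTensor

variable {A C : Type*} [CStarAlgebra A] [PartialOrder A] [StarOrderedRing A]
  [CStarAlgebra C] [PartialOrder C] [StarOrderedRing C]

variable (A C) in
/-- The canonical map of the algebraic tensor product into the spatial tensor product. -/
def ofTensor : A ⊗[ℂ] C →⋆ₐ[ℂ] SpatialTensor A C :=
  StarAlgHom.codRestrict (spatialHom A C) (spatialTensor A C) spatialHom_mem

end SpatialTensor

/-! ### Matrix units, and the passage from operators on `K` to `A ⊗ C` -/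

namespace CStarMatrix

variable {ι : Type*} [DecidableEq ι]

/-- The matrix units. -/
def matrixUnit (i j : ι) : CStarMatrix ι ι ℂ := ofMatrix (Matrix.single i j 1)

theorem matrixUnit_apply (i j k l : ι) : matrixUnit i j k l = if i = k ∧ j = l then 1 else 0 := by
  simp [matrixUnit, ofMatrix_apply, Matrix.single_apply]

theorem star_matrixUnit (i j : ι) : star (matrixUnit i j) = matrixUnit j i := by
  ext a b
  simp [star_apply, matrixUnit_apply, and_comm, apply_ite]

variable [Fintype ι]

theorem matrixUnit_mul_matrixUnit (i j k l : ι) :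
    matrixUnit i j * matrixUnit k l = if j = k then matrixUnit i l else 0 := by
  ext a b
  split_ifs with h
  · subst h
    simp only [mul_apply, matrixUnit_apply]
    rw [Finset.sum_eq_single j] <;> grind
  · simp only [mul_apply, matrixUnit_apply, zero_apply]
    refine Finset.sum_eq_zero fun x _ => ?_
    grind

theorem sum_matrixUnit : ∑ i : ι, matrixUnit i i = 1 := by
  change ∑ i, ofMatrixₗ (R := ℂ) (Matrix.single i i 1) = ofMatrixₗ (R := ℂ) 1
  rw [← map_sum, Matrix.sum_single_one]

end CStarMatrix

/-- A system of matrix units in a ⋆-algebra. -/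
structure IsMatrixUnits {ι C : Type*} [Fintype ι] [DecidableEq ι] [CStarAlgebra C]
    (e : ι → ι → C) : Prop where
  mul : ∀ i j k l, e i j * e k l = if j = k then e i l else 0
  star_eq : ∀ i j, star (e i j) = e j i
  sum_eq_one : ∑ i, e i i = 1

theorem CStarMatrix.isMatrixUnits_matrixUnit {ι : Type*} [Fintype ι] [DecidableEq ι] :
    IsMatrixUnits (matrixUnit : ι → ι → CStarMatrix ι ι ℂ) where
  mul := matrixUnit_mul_matrixUnit
  star_eq := star_matrixUnit
  sum_eq_one := sum_matrixUnit

section ToTensor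

variable {ι A C : Type*} [Fintype ι] [DecidableEq ι] [CStarAlgebra A] [CStarAlgebra C]
  {e : ι → ι → C}

/-- The ⋆-homomorphism `M ↦ ∑ᵢⱼ Mᵢⱼ ⊗ eᵢⱼ` into the algebraic tensor product. -/
def IsMatrixUnits.toTensor (he : IsMatrixUnits e) : CStarMatrix ι ι A →⋆ₐ[ℂ] A ⊗[ℂ] C where
  __ := AlgHom.ofLinearMap
    { toFun M := ∑ i, ∑ j, M i j ⊗ₜ[ℂ] e i j
      map_add' M N := by
        simp [TensorProduct.add_tmul, Finset.sum_add_distrib]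
      map_smul' r M := by
        simp [← TensorProduct.smul_tmul', Finset.smul_sum] }
    (by
      change ∑ i, ∑ j, (1 : CStarMatrix ι ι A) i j ⊗ₜ[ℂ] e i j = 1
      simp only [CStarMatrix.one_apply, TensorProduct.ite_tmul, Finset.sum_ite_eq, Finset.mem_univ, if_true]
      rw [← TensorProduct.tmul_sum, he.sum_eq_one, Algebra.TensorProduct.one_def])
    (fun M N => by
      change ∑ i, ∑ j, (M * N) i j ⊗ₜ[ℂ] e i j =
        (∑ i, ∑ j, M i j ⊗ₜ[ℂ] e i j) * ∑ i, ∑ j, N i j ⊗ₜ[ℂ] e i j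
      rw [Finset.sum_mul]
      refine Finset.sum_congr rfl fun i _ => ?_
      simp only [CStarMatrix.mul_apply, TensorProduct.sum_tmul]
      rw [Finset.sum_comm, Finset.sum_mul]
      refine Finset.sum_congr rfl fun j _ => ?_
      simp only [Finset.mul_sum, Algebra.TensorProduct.tmul_mul_tmul, he.mul]
      rw [Finset.sum_comm]
      refine Finset.sum_congr rfl fun k _ => ?_
      -- Only the products of matrix units whose inner indices agree survive, which leaves the
      -- matrix product.
      rw [Finset.sum_eq_single j (fun l _ hl => by rw [if_neg hl.symm, TensorProduct.tmul_zero])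
        (fun h => absurd (Finset.mem_univ j) h), if_pos rfl])
  map_star' M := by
    change ∑ i, ∑ j, (star M) i j ⊗ₜ[ℂ] e i j = star (∑ i, ∑ j, M i j ⊗ₜ[ℂ] e i j)
    simp only [star_sum, TensorProduct.star_tmul, he.star_eq, CStarMatrix.star_apply]
    exact Finset.sum_comm

theorem IsMatrixUnits.toTensor_apply (he : IsMatrixUnits e) (M : CStarMatrix ι ι A) :
    he.toTensor M = ∑ i, ∑ j, M i j ⊗ₜ[ℂ] e i j := rfl

end ToTensor

/-- An operator on `K` as a matrix of operators on `H`, along a decomposition of `K` into copies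
of `H` given by isometries `V i` with orthogonal ranges. -/
def blockMatrixHom {ι H K : Type*} [Fintype ι] [DecidableEq ι]
    [NormedAddCommGroup H] [InnerProductSpace ℂ H] [CompleteSpace H]
    [NormedAddCommGroup K] [InnerProductSpace ℂ K] [CompleteSpace K]
    (V : ι → H →L[ℂ] K)
    (hV : ∀ i j, (V i).adjoint ∘L V j = if i = j then 1 else 0)
    (hsum : ∑ i, V i ∘L (V i).adjoint = 1) :
    (K →L[ℂ] K) →⋆ₐ[ℂ] CStarMatrix ι ι (H →L[ℂ] H) where
  __ := AlgHom.ofLinearMap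
    { toFun S := CStarMatrix.ofMatrix fun i j => (V i).adjoint ∘L S ∘L V j
      map_add' S T := by
        refine CStarMatrix.ext fun i j => ?_
        change (V i).adjoint ∘L (S + T) ∘L V j =
          (V i).adjoint ∘L S ∘L V j + (V i).adjoint ∘L T ∘L V j
        ext x
        simp
      map_smul' r S := by
        refine CStarMatrix.ext fun i j => ?_
        change (V i).adjoint ∘L (r • S) ∘L V j = r • ((V i).adjoint ∘L S ∘L V j)
        ext x
        simp }
    (by
      refine CStarMatrix.ext fun i j => ?_
      rw [CStarMatrix.one_apply, ← hV]
      rfl)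
    (fun S T => by
      refine CStarMatrix.ext fun i j => ?_
      rw [CStarMatrix.mul_apply]
      change (V i).adjoint ∘L (S * T) ∘L V j =
        ∑ k, ((V i).adjoint ∘L S ∘L V k) ∘L ((V k).adjoint ∘L T ∘L V j)
      ext x
      -- Multiplicativity amounts to inserting the resolution of the identity `hsum` between `S` and
      -- `T`.
      have h := congrArg (fun R : K →L[ℂ] K => (V i).adjoint (S (R (T (V j x))))) hsum
      simpa using h.symm)
  map_star' S := by
    refine CStarMatrix.ext fun i j => ?_
    change (V i).adjoint ∘L star S ∘L V j = star ((V j).adjoint ∘L S ∘L V i)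
    simp [ContinuousLinearMap.star_eq_adjoint, ContinuousLinearMap.adjoint_comp,
      ContinuousLinearMap.comp_assoc]

/-! ### States that detect nonzero elements and elementary tensors -/

section GNS

variable {A C : Type*} [CStarAlgebra A] [PartialOrder A] [StarOrderedRing A]
  [CStarAlgebra C] [PartialOrder C] [StarOrderedRing C]

/-- The cyclic vector of the GNS representation. -/
def CStarState.cyclicVector (f : CStarState A) : f.Space :=
  ((f.1.toPreGNS 1 : f.1.PreGNS) : f.1.GNS)

/-- The squared norm of this vector is `f (star a * a)`. -/
theorem CStarState.gns_cyclicVector_ne_zero (f : CStarState A) {a : A} (h : f (star a * a) ≠ 0) :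
    f.1.gnsStarAlgHom a f.cyclicVector ≠ 0 := by
  have h1 : f.1.gnsStarAlgHom a f.cyclicVector =
      ((f.1.toPreGNS a : f.1.PreGNS) : f.1.GNS) := by
    change f.1.gnsNonUnitalStarAlgHom a ((f.1.toPreGNS 1 : f.1.PreGNS) : f.1.GNS) = _
    rw [PositiveLinearMap.gnsNonUnitalStarAlgHom_apply_coe]
    simp
  intro h0
  rw [h1] at h0
  have h2 : ‖f.1.toPreGNS a‖ = 0 := by rw [← Completion.norm_coe, h0, norm_zero]
  have h3 := f.1.preGNS_norm_sq (f.1.toPreGNS a)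
  rw [h2] at h3
  apply h
  simpa using h3.symm

/-- The component at `(f, g)` sends the tensor of the cyclic vectors to an elementary tensor of two
nonzero vectors, whose norm is the product of theirs. -/
theorem SpatialTensor.tmul_ne_zero (f : CStarState A) (g : CStarState C) {a : A} {c : C}
    (ha : f (star a * a) ≠ 0) (hc : g (star c * c) ≠ 0) : spatialTmul a c ≠ 0 := by
  intro h
  have h1 : (spatialHom A C (a ⊗ₜ[ℂ] c)).component (f, g) = 0 := by
    have : spatialHom A C (a ⊗ₜ[ℂ] c) = 0 := congrArg Subtype.val h
    rw [this]
    rfl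
  rw [spatialHom_tmul_component] at h1
  have h2 := DFunLike.congr_fun h1 ((f.cyclicVector ⊗ₜ[ℂ] g.cyclicVector :
    f.Space ⊗[ℂ] g.Space) : HilbertTensor f.Space g.Space)
  rw [opTensor_tmul] at h2
  have h3 := congrArg norm h2
  rw [Completion.norm_coe, TensorProduct.norm_tmul] at h3
  exact mul_ne_zero (norm_ne_zero_iff.2 (f.gns_cyclicVector_ne_zero ha))
    (norm_ne_zero_iff.2 (g.gns_cyclicVector_ne_zero hc)) (h3.trans norm_zero)

end GNS

section VectorState

variable {H : Type*} [NormedAddCommGroup H] [InnerProductSpace ℂ H] [CompleteSpace H]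

/-- The state `S ↦ ⟪ξ, S ξ⟫` of a unit vector. -/
def vectorState (ξ : H) (hξ : ‖ξ‖ = 1) : CStarState (H →L[ℂ] H) :=
  ⟨PositiveLinearMap.mk₀
    { toFun S := ⟪ξ, S ξ⟫_ℂ
      map_add' _ _ := by simp
      map_smul' _ _ := by simp }
    (fun S hS => by
      rw [ContinuousLinearMap.nonneg_iff_isPositive] at hS
      exact hS.inner_nonneg_right ξ), by
      change ⟪ξ, ξ⟫_ℂ = 1
      simp [inner_self_eq_norm_sq_to_K, hξ]⟩

theorem vectorState_apply (ξ : H) (hξ : ‖ξ‖ = 1) (S : H →L[ℂ] H) :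
    vectorState ξ hξ S = ⟪ξ, S ξ⟫_ℂ := rfl

/-- A unit vector `ξ` with `S ξ ≠ 0` gives the value `‖S ξ‖²`. When `H = 0` there are no states at
all, but then no nonzero `S` either. -/
theorem exists_state_star_mul_self_ne_zero {S : H →L[ℂ] H} (hS : S ≠ 0) :
    ∃ f : CStarState (H →L[ℂ] H), f (star S * S) ≠ 0 := by
  obtain ⟨x, hx⟩ : ∃ x, S x ≠ 0 := by
    by_contra! h
    exact hS (ContinuousLinearMap.ext h)
  have hx0 : x ≠ 0 := by
    rintro rfl
    exact hx (map_zero S)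
  refine ⟨vectorState (((‖x‖ : ℂ)⁻¹) • x) (norm_smul_inv_norm hx0), ?_⟩
  rw [vectorState_apply, mul_apply_eq_comp, ContinuousLinearMap.star_eq_adjoint,
    ContinuousLinearMap.adjoint_inner_right, inner_self_ne_zero, map_smul]
  exact smul_ne_zero (inv_ne_zero (by simpa using hx0)) hx

end VectorState

/-! ### Existence of the slice map -/

section Slice

open SpatialTensor

variable {A C X : Type*} [CStarAlgebra A] [CStarAlgebra C] [CStarAlgebra X]

/-- The map `a ↦ f (a ⊗ p)` for a projection `p`. -/
def compTmulProjection (f : A ⊗[ℂ] C →⋆ₐ[ℂ] X) (p : C) (hp : star p = p) (hpp : p * p = p) :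
    A →⋆ₙₐ[ℂ] X where
  toFun a := f (a ⊗ₜ p)
  map_smul' r a := by
    rw [← TensorProduct.smul_tmul', map_smul]
    rfl
  map_zero' := by rw [TensorProduct.zero_tmul, map_zero]
  map_add' a b := by rw [TensorProduct.add_tmul, map_add]
  map_mul' a b := by rw [← map_mul, Algebra.TensorProduct.tmul_mul_tmul, hpp]
  map_star' a := by rw [← map_star, TensorProduct.star_tmul, hp]

/-- The functional is recovered from compression: the slice of `x` is the unique `a` with `f (a ⊗ p)
= e x e`, where `e = f (1 ⊗ p)`. An injective ⋆-homomorphism of C⋆-algebras is isometric, so the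
copy of `A` is closed and the relation passes from the algebraic tensor product to its closure. -/
theorem exists_clm_of_starTensorClosedRange (f : A ⊗[ℂ] C →⋆ₐ[ℂ] X) (ν : C → ℂ) (p : C)
    (hp : star p = p) (hpp : p * p = p) (hmin : ∀ c, p * c * p = ν c • p)
    (hf : ∀ a : A, a ≠ 0 → f (a ⊗ₜ p) ≠ 0) :
    ∃ T : ↥(starTensorClosedRange f) →L[ℂ] A,
      ∀ a c, T ⟨f (a ⊗ₜ c), mem_starTensorClosedRange f _⟩ = ν c • a := by
  set j := compTmulProjection f p hp hpp with hjdef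
  have hj : Function.Injective j := by
    rw [injective_iff_map_eq_zero]
    intro a h
    by_contra ha
    exact hf a ha h
  have hjn := NonUnitalStarAlgHom.norm_map j hj
  set e : X := f (1 ⊗ₜ p) with he
  have htmul : ∀ (a : A) (c : C), j (ν c • a) = e * f (a ⊗ₜ c) * e := by
    intro a c
    change f ((ν c • a) ⊗ₜ p) = _
    rw [he, ← map_mul, ← map_mul, Algebra.TensorProduct.tmul_mul_tmul,
      Algebra.TensorProduct.tmul_mul_tmul, hmin, one_mul, mul_one, TensorProduct.tmul_smul,
      TensorProduct.smul_tmul']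
  have hcl : IsClosed {x : X | e * x * e ∈ Set.range j} :=
    (NonUnitalStarAlgHom.isometry j hj).isClosedEmbedding.isClosed_range.preimage (by fun_prop)
  have hall : ∀ x : ↥(starTensorClosedRange f), ∃ a, j a = e * x * e := by
    rintro ⟨x, hx⟩
    refine closure_minimal ?_ hcl hx
    rintro _ ⟨t, rfl⟩
    change e * f t * e ∈ Set.range j
    induction t using TensorProduct.induction_on with
    | zero => exact ⟨0, by rw [map_zero, map_zero, mul_zero, zero_mul]⟩
    | tmul a c => exact ⟨ν c • a, htmul a c⟩
    | add s t hs ht =>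
      obtain ⟨a, ha⟩ := hs
      obtain ⟨b, hb⟩ := ht
      exact ⟨a + b, by rw [map_add, map_add, ha, hb, mul_add, add_mul]⟩
  choose T hT using hall
  refine ⟨LinearMap.mkContinuous
    { toFun := T
      map_add' x y := hj (by
        rw [map_add, hT, hT, hT, ← add_mul, ← mul_add]
        rfl)
      map_smul' r x := hj (by
        rw [RingHom.id_apply, map_smul, hT, hT, ← smul_mul_assoc, ← mul_smul_comm]
        rfl) }
    -- The bound is that of `x ↦ e x e`, since `j` preserves norms.
    (‖e‖ * ‖e‖) fun x => ?_, fun a c => hj ((hT _).trans (htmul a c).symm)⟩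
  change ‖T x‖ ≤ _
  rw [← hjn, hT]
  calc ‖e * (x : X) * e‖ ≤ ‖e‖ * ‖(x : X)‖ * ‖e‖ := norm_mul₃_le
    _ = ‖e‖ * ‖e‖ * ‖x‖ := by
      rw [mul_right_comm]
      rfl

theorem starTensorClosedRange_clm_add (f : A ⊗[ℂ] C →⋆ₐ[ℂ] X)
    (T : ↥(starTensorClosedRange f) →L[ℂ] A) (s t : A ⊗[ℂ] C) :
    T ⟨f (s + t), mem_starTensorClosedRange f _⟩ =
      T ⟨f s, mem_starTensorClosedRange f _⟩ + T ⟨f t, mem_starTensorClosedRange f _⟩ := by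
  rw [← map_add]
  exact congrArg T (Subtype.ext (map_add f s t))

variable [PartialOrder A] [StarOrderedRing A] [PartialOrder C] [StarOrderedRing C]

theorem exists_isSliceMap (hA : ∀ a : A, a ≠ 0 → ∃ f : CStarState A, f (star a * a) ≠ 0)
    (ν : CStarState C) (p : C) (hp : star p = p) (hpp : p * p = p) (hν : ν p = 1)
    (hmin : ∀ c, p * c * p = ν c • p) :
    ∃ T : SpatialTensor A C →L[ℂ] A, IsSliceMap ν T := by
  refine exists_clm_of_starTensorClosedRange (spatialHom A C) ν p hp hpp hmin fun a ha h => ?_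
  obtain ⟨f, hf⟩ := hA a ha
  refine tmul_ne_zero f ν hf ?_ (Subtype.ext h)
  rw [hp, hpp, hν]
  exact one_ne_zero

end Slice

/-! ### From a matrix-valued morphism to an implementation -/

section Dilation

open CStarMatrix SpatialTensor

/-- The corner is a minimal projection whose compression is the corner state; this is the hypothesis
`hmin` of the slice construction. -/
theorem CStarMatrix.corner_mul_mul_corner {n : ℕ} [NeZero n]
    (c : CStarMatrix (Fin n) (Fin n) ℂ) :
    matrixUnit 0 0 * c * matrixUnit 0 0 = c 0 0 • matrixUnit 0 0 := by
  ext i j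
  simp only [mul_apply, matrixUnit_apply, smul_apply]
  rw [Finset.sum_eq_single 0, Finset.sum_eq_single 0] <;> simp +contextual [eq_comm, ite_and]
  split_ifs <;> rfl

variable {A B C ι : Type*} [CStarAlgebra A] [CStarAlgebra C] [Fintype ι] [DecidableEq ι]
  {e : ι → ι → C} {o : ι}

theorem IsMatrixUnits.map_toTensor (he : IsMatrixUnits e) {ν : C → ℂ}
    (hν : ∀ i j, ν (e i j) = if i = o ∧ j = o then 1 else 0)
    (T : A ⊗[ℂ] C →+ A) (hT : ∀ a c, T (a ⊗ₜ c) = ν c • a)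
    (M : CStarMatrix ι ι A) : T (he.toTensor M) = M o o := by
  rw [he.toTensor_apply]
  simp only [map_sum, hT, hν, ite_smul, one_smul, zero_smul]
  rw [Finset.sum_eq_single o, Finset.sum_eq_single o] <;> simp +contextual

theorem exists_implementedBy_of_isMatrixUnits [PartialOrder A] [StarOrderedRing A]
    [CStarAlgebra B] [PartialOrder B] [StarOrderedRing B] [PartialOrder C] [StarOrderedRing C]
    (hA : ∀ a : A, a ≠ 0 → ∃ f : CStarState A, f (star a * a) ≠ 0) (he : IsMatrixUnits e)
    (ν : CStarState C) (hν : ∀ i j, ν (e i j) = if i = o ∧ j = o then 1 else 0)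
    (hmin : ∀ c, e o o * c * e o o = ν c • e o o)
    (F : B →CP A) (ρ : B →⋆ₐ[ℂ] CStarMatrix ι ι A) (hF : ∀ b, F b = ρ b o o) :
    ∃ φ : B →⋆ₐ[ℂ] SpatialTensor A C, ImplementedBy F φ ν := by
  obtain ⟨T, hT⟩ := exists_isSliceMap hA ν (e o o) (he.star_eq o o)
    ((he.mul o o o o).trans (if_pos rfl)) ((hν o o).trans (if_pos ⟨rfl, rfl⟩)) hmin
  refine ⟨(ofTensor A C).comp (he.toTensor.comp ρ), T, hT, fun b => ?_⟩
  -- Additivity and the values on elementary tensors are all that `map_toTensor` needs.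
  have hadd : ∀ s t, T (ofTensor A C (s + t)) = T (ofTensor A C s) + T (ofTensor A C t) :=
    starTensorClosedRange_clm_add (spatialHom A C) T
  exact (hF b).trans (he.map_toTensor hν
    (AddMonoidHom.mk' (fun s => T (ofTensor A C s)) hadd) (fun a c => hT a c) (ρ b)).symm

theorem exists_implements_cornerState [PartialOrder A] [StarOrderedRing A]
    [CStarAlgebra B] [PartialOrder B] [StarOrderedRing B]
    (hA : ∀ a : A, a ≠ 0 → ∃ f : CStarState A, f (star a * a) ≠ 0) {n : ℕ} [NeZero n]
    (F : B →CP A) (ρ : B →⋆ₐ[ℂ] CStarMatrix (Fin n) (Fin n) A) (hF : ∀ b, F b = ρ b 0 0) :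
    IsImplemented.{_, _, 0} F ∧
      ∃ φ : B →⋆ₐ[ℂ] SpatialTensor A (CStarMatrix (Fin n) (Fin n) ℂ),
        RandomQuantumMap.Implements
          { C := CStarMatrix (Fin n) (Fin n) ℂ, φ := φ, ν := cornerState n } F := by
  obtain ⟨φ, hφ⟩ := exists_implementedBy_of_isMatrixUnits hA isMatrixUnits_matrixUnit
    (cornerState n) (fun i j => matrixUnit_apply i j 0 0) corner_mul_mul_corner F ρ hF
  exact ⟨⟨{ C := CStarMatrix (Fin n) (Fin n) ℂ, φ := φ, ν := cornerState n }, hφ⟩, φ, hφ⟩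

end Dilation

/-! ### Decomposing a Hilbert space into copies of another -/

section HilbertSpaces

variable {E F : Type*} [NormedAddCommGroup E] [InnerProductSpace ℂ E]
  [NormedAddCommGroup F] [InnerProductSpace ℂ F]

/-- Distinct orthonormal vectors lie at distance `√2`, so the balls of radius 1/2 around them are
disjoint open sets. -/
theorem Orthonormal.countable_of_separableSpace [TopologicalSpace.SeparableSpace E] {s : Set E}
    (hs : Orthonormal ℂ ((↑) : s → E)) : s.Countable := by
  have hdist : ∀ x ∈ s, ∀ y ∈ s, x ≠ y → 1 ≤ dist x y := by
    intro x hx y hy hxy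
    have hxn : ‖x‖ = 1 := hs.1 ⟨x, hx⟩
    have hyn : ‖y‖ = 1 := hs.1 ⟨y, hy⟩
    have h0 : ⟪x, y⟫_ℂ = 0 := hs.2 (i := ⟨x, hx⟩) (j := ⟨y, hy⟩) (by simpa using hxy)
    have h1 := @norm_sub_sq ℂ E _ _ _ x y
    rw [h0, hxn, hyn] at h1
    norm_num at h1
    rw [dist_eq_norm]
    nlinarith [norm_nonneg (x - y)]
  refine Set.PairwiseDisjoint.countable_of_isOpen (s := fun x => Metric.ball x (1 / 2)) ?_
    (fun _ _ => Metric.isOpen_ball) (fun x _ => ⟨x, Metric.mem_ball_self (by norm_num)⟩)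
  intro x hx y hy hxy
  exact Metric.ball_disjoint_ball (by have := hdist x hx y hy hxy; linarith)

variable (E) in
theorem exists_hilbertBasis_nat [CompleteSpace E] [TopologicalSpace.SeparableSpace E]
    (hE : ¬ FiniteDimensional ℂ E) : Nonempty (HilbertBasis ℕ ℂ E) := by
  obtain ⟨w, b, hb⟩ := exists_hilbertBasis ℂ E
  have hw : Orthonormal ℂ ((↑) : w → E) := hb ▸ b.orthonormal
  have : Countable w := hw.countable_of_separableSpace.to_subtype
  have : Infinite w := by
    by_contra hfin
    rw [not_infinite_iff_finite] at hfin
    have := Fintype.ofFinite w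
    exact hE b.toOrthonormalBasis.toBasis.finiteDimensional_of_finite
  obtain ⟨σ⟩ := nonempty_equiv_of_countable (α := ℕ) (β := w)
  refine ⟨HilbertBasis.mk (b.orthonormal.comp σ σ.injective) ?_⟩
  rw [Set.range_comp, σ.surjective.range_eq, Set.image_univ, b.dense_span]

theorem nonempty_linearIsometryEquiv_of_separableSpace [CompleteSpace E] [CompleteSpace F]
    [TopologicalSpace.SeparableSpace E] [TopologicalSpace.SeparableSpace F]
    (hE : ¬ FiniteDimensional ℂ E) (hF : ¬ FiniteDimensional ℂ F) :
    Nonempty (E ≃ₗᵢ[ℂ] F) := by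
  obtain ⟨b⟩ := exists_hilbertBasis_nat E hE
  obtain ⟨c⟩ := exists_hilbertBasis_nat F hF
  exact ⟨b.repr.trans c.repr.symm⟩

theorem nonempty_linearIsometryEquiv_of_finrank_eq [FiniteDimensional ℂ E]
    [FiniteDimensional ℂ F] (h : Module.finrank ℂ E = Module.finrank ℂ F) :
    Nonempty (E ≃ₗᵢ[ℂ] F) :=
  ⟨(stdOrthonormalBasis ℂ E).equiv (stdOrthonormalBasis ℂ F) (finCongr h)⟩

/-- Isometries `V i : E → F` with orthogonal ranges spanning `F`. -/
structure IsIsometricDecomposition [CompleteSpace E] [CompleteSpace F] {ι : Type*} [Fintype ι]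
    [DecidableEq ι] (V : ι → E →L[ℂ] F) : Prop where
  adjoint_comp : ∀ i j, (V i).adjoint ∘L V j = if i = j then 1 else 0
  sum_comp_adjoint : ∑ i, V i ∘L (V i).adjoint = 1

theorem LinearIsometryEquiv.isIsometricDecomposition [CompleteSpace E] [CompleteSpace F]
    (e : E ≃ₗᵢ[ℂ] F) :
    IsIsometricDecomposition fun _ : Fin 1 => (e.toContinuousLinearEquiv : E →L[ℂ] F) where
  adjoint_comp i j := by
    rw [if_pos (Subsingleton.elim i j), e.adjoint_eq_symm]
    ext x
    simp
  sum_comp_adjoint := by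
    rw [Fin.sum_univ_one, e.adjoint_eq_symm]
    ext x
    simp

/-- By dimension `F` is isometric to the ℓ² sum of `m` copies of `E`; the `V i` are the coordinate
embeddings, with the coordinate projections as adjoints. The case `m = 0` is allowed and means `F =
0`. -/
theorem exists_isIsometricDecomposition_of_finrank_eq [FiniteDimensional ℂ E]
    [FiniteDimensional ℂ F] [CompleteSpace E] [CompleteSpace F] {m : ℕ}
    (h : Module.finrank ℂ F = m * Module.finrank ℂ E) :
    ∃ V : Fin m → E →L[ℂ] F, IsIsometricDecomposition V := by
  obtain ⟨e⟩ := nonempty_linearIsometryEquiv_of_finrank_eq (E := PiLp 2 fun _ : Fin m => E)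
    (F := F) (by
      rw [h, LinearEquiv.finrank_eq (WithLp.linearEquiv 2 ℂ (Fin m → E)), Module.finrank_pi_fintype]
      simp)
  let V : Fin m → E →L[ℂ] F := fun i => (e.toContinuousLinearEquiv : _ →L[ℂ] F) ∘L
    ((PiLp.continuousLinearEquiv 2 ℂ fun _ : Fin m => E).symm :
      (Fin m → E) →L[ℂ] PiLp 2 fun _ : Fin m => E) ∘L
      ContinuousLinearMap.single ℂ (fun _ : Fin m => E) i
  have hV : ∀ i x, V i x = e (PiLp.single 2 i x) := fun _ _ => rfl
  have hadj : ∀ i y, (V i).adjoint y = e.symm y i := by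
    intro i y
    refine ext_inner_left ℂ fun x => ?_
    rw [ContinuousLinearMap.adjoint_inner_right, hV, ← e.symm.inner_map_map, e.symm_apply_apply,
      PiLp.inner_apply, Finset.sum_eq_single i]
    · rw [PiLp.single_eq_same]
    · intro j _ hj
      rw [PiLp.single_eq_of_ne 2 hj, inner_zero_left]
    · simp
  refine ⟨V, ⟨fun i j => ?_, ?_⟩⟩
  · ext x
    rw [ContinuousLinearMap.comp_apply, hadj, hV, e.symm_apply_apply]
    split_ifs with h
    · subst h
      rw [PiLp.single_eq_same]
      rfl
    · rw [PiLp.single_eq_of_ne 2 h]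
      rfl
  · ext y
    simp only [sum_apply, ContinuousLinearMap.comp_apply, hadj, hV]
    rw [← map_sum]
    change e _ = y
    rw [← e.eq_symm_apply]
    ext j
    rw [WithLp.ofLp_sum, Finset.sum_apply, Finset.sum_eq_single j]
    · exact PiLp.single_eq_same 2 j _
    · exact fun i _ hi => PiLp.single_eq_of_ne 2 hi.symm _
    · simp

/-- Completing the inclusion of `H` by a decomposition of `Hᗮ` into copies of `H`. -/
theorem IsIsometricDecomposition.cons_subtypeL [CompleteSpace E] (H : Submodule ℂ E)
    [CompleteSpace H] {m : ℕ} {W : Fin m → H →L[ℂ] Hᗮ} (hW : IsIsometricDecomposition W) :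
    IsIsometricDecomposition
      (Fin.cons H.subtypeL fun i => Hᗮ.subtypeL ∘L W i : Fin (m + 1) → H →L[ℂ] E) where
  adjoint_comp i j := by
    refine Fin.cases ?_ (fun i => ?_) i <;> refine Fin.cases ?_ (fun j => ?_) j
    · ext x
      simp [Submodule.adjoint_subtypeL]
    · ext x
      simp [Submodule.adjoint_subtypeL, (Fin.succ_ne_zero j).symm]
      exact Submodule.starProjection_apply_eq_zero_iff H |>.2 (W j x).2
    · ext x
      simp [Submodule.adjoint_subtypeL, ContinuousLinearMap.adjoint_comp, Fin.succ_ne_zero i]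
      rw [Submodule.orthogonalProjectionOnto_orthogonal_apply_eq_zero x.2, map_zero]
    · rw [Fin.cons_succ, Fin.cons_succ, ContinuousLinearMap.adjoint_comp,
        Submodule.adjoint_subtypeL]
      have h := hW.adjoint_comp i j
      simp only [Fin.succ_inj]
      rw [← h]
      ext x
      simp
  sum_comp_adjoint := by
    rw [Fin.sum_univ_succ]
    simp only [Fin.cons_zero, Fin.cons_succ, ContinuousLinearMap.adjoint_comp,
      Submodule.adjoint_subtypeL]
    ext x
    -- The copies inside `Hᗮ` sum to the projection onto `Hᗮ`; the projection onto `H` is what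
    -- completes it to the identity.
    have h := congrArg (fun S : Hᗮ →L[ℂ] Hᗮ => ((S (Hᗮ.orthogonalProjectionOnto x) : Hᗮ) : E))
      hW.sum_comp_adjoint
    simp only [sum_apply, ContinuousLinearMap.comp_apply,
      Submodule.coe_sum] at h
    simp only [add_apply, sum_apply,
      ContinuousLinearMap.comp_apply, Submodule.subtypeL_apply]
    rw [h]
    exact H.starProjection_add_starProjection_orthogonal x

end HilbertSpaces

/-! ### The dilation theorem -/

theorem exists_implements_of_orthogonal_decomposition {B K : Type*} [CStarAlgebra B]
    [PartialOrder B] [StarOrderedRing B]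
    [NormedAddCommGroup K] [InnerProductSpace ℂ K] [CompleteSpace K]
    (H : Submodule ℂ K) [CompleteSpace H] (F : B →CP (H →L[ℂ] H)) (ψ : B →⋆ₐ[ℂ] (K →L[ℂ] K))
    (hψ : ∀ b : B, F b = H.orthogonalProjectionOnto ∘L ψ b ∘L H.subtypeL)
    {m n : ℕ} [NeZero n] (hn : n = m + 1) {W : Fin m → H →L[ℂ] Hᗮ}
    (hW : IsIsometricDecomposition W) :
    IsImplemented.{_, _, 0} (A := H →L[ℂ] H) F ∧
      ∃ φ : B →⋆ₐ[ℂ] SpatialTensor (H →L[ℂ] H) (CStarMatrix (Fin n) (Fin n) ℂ),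
        RandomQuantumMap.Implements
          { C := CStarMatrix (Fin n) (Fin n) ℂ, φ := φ, ν := cornerState n } F := by
  subst hn
  have hV := hW.cons_subtypeL H
  exact exists_implements_cornerState (A := H →L[ℂ] H)
    (fun _ => exists_state_star_mul_self_ne_zero) F
    ((blockMatrixHom _ hV.adjoint_comp hV.sum_comp_adjoint).comp ψ) fun b => by
      -- The isometry with index 0 is the inclusion of `H`, whose adjoint is the projection onto
      -- `H`; the (0,0) block is then the compression by definition.
      rw [hψ, ← Submodule.adjoint_subtypeL]
      rfl

end

theorem mainTheorem4 {B K : Type*} [CStarAlgebra B] [PartialOrder B] [StarOrderedRing B]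
    [NormedAddCommGroup K] [InnerProductSpace ℂ K] [CompleteSpace K]
    (H : Submodule ℂ K) [CompleteSpace H]
    (F : B →CP (H →L[ℂ] H)) (hF : F 1 = 1)
    (ψ : B →⋆ₐ[ℂ] (K →L[ℂ] K))
    (hψ : ∀ b : B, F b = H.orthogonalProjectionOnto ∘L ψ b ∘L H.subtypeL) :
    (TopologicalSpace.SeparableSpace H → TopologicalSpace.SeparableSpace K →
      ¬ FiniteDimensional ℂ H → ¬ FiniteDimensional ℂ K → ¬ FiniteDimensional ℂ Hᗮ →
        IsImplemented.{_, _, 0} (A := H →L[ℂ] H) F ∧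
        ∃ φ : B →⋆ₐ[ℂ] SpatialTensor (H →L[ℂ] H) (CStarMatrix (Fin 2) (Fin 2) ℂ),
          RandomQuantumMap.Implements
            { C := CStarMatrix (Fin 2) (Fin 2) ℂ, φ := φ, ν := cornerState 2 } F) ∧
    (FiniteDimensional ℂ K → Module.finrank ℂ H ∣ Module.finrank ℂ K →
        IsImplemented.{_, _, 0} (A := H →L[ℂ] H) F ∧
        ∀ (n : ℕ) [NeZero n], Module.finrank ℂ K = n * Module.finrank ℂ H →
          ∃ φ : B →⋆ₐ[ℂ] SpatialTensor (H →L[ℂ] H) (CStarMatrix (Fin n) (Fin n) ℂ),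
            RandomQuantumMap.Implements
              { C := CStarMatrix (Fin n) (Fin n) ℂ, φ := φ, ν := cornerState n } F) := by
  constructor
  · intro hHs hKs hH _ hHo
    -- Second countability, unlike separability, passes to subspaces; it makes `Hᗮ` separable.
    have : SecondCountableTopology K := UniformSpace.secondCountable_of_separable K
    obtain ⟨e⟩ := nonempty_linearIsometryEquiv_of_separableSpace hH hHo
    exact exists_implements_of_orthogonal_decomposition H F ψ hψ rfl e.isIsometricDecomposition
  · intro hK hdvd
    have hsum := H.finrank_add_finrank_orthogonal
    have key : ∀ (n : ℕ) [NeZero n], Module.finrank ℂ K = n * Module.finrank ℂ H →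
        ∃ m, n = m + 1 ∧ ∃ W : Fin m → H →L[ℂ] Hᗮ, IsIsometricDecomposition W := by
      intro n hn h
      obtain ⟨m, rfl⟩ := Nat.exists_eq_succ_of_ne_zero hn.out
      refine ⟨m, rfl, exists_isIsometricDecomposition_of_finrank_eq ?_⟩
      -- Subtracting the copy `H` itself leaves `dim Hᗮ = m dim H`.
      rw [h, Nat.succ_mul] at hsum
      omega
    constructor
    · obtain ⟨k, hk⟩ := hdvd
      obtain ⟨n, hn0, hn⟩ : ∃ n : ℕ, n ≠ 0 ∧ Module.finrank ℂ K = n * Module.finrank ℂ H := by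
        -- The quotient must be nonzero to serve as a matrix size. If `k = 0`, then `K = 0` and
        -- hence `H = 0`, so the size 1 works.
        rcases eq_or_ne k 0 with rfl | hk0
        · exact ⟨1, one_ne_zero, by omega⟩
        · exact ⟨k, hk0, hk.trans (mul_comm _ _)⟩
      have : NeZero n := ⟨hn0⟩
      obtain ⟨m, hm, W, hW⟩ := key n hn
      exact (exists_implements_of_orthogonal_decomposition H F ψ hψ hm hW).1
    · intro n _ hn
      obtain ⟨m, hm, W, hW⟩ := key n hn
      exact (exists_implements_of_orthogonal_decomposition H F ψ hψ hm hW).2
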